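/- For a finite oriented graph $D$ (a finite digraph with no loops, no parallel arcs and no directed 2-cycles), the dichromatic number $\vec\chi(D)$ is the least integer $k$ such that the vertex set $V(D)$ can be partitioned into $k$ (possibly empty) sets, each inducing an acyclic subdigraph of $D$. The independence number of $D$ is the maximum size of a set of vertices containing no arc of $D$. For an arc $e=uv$ (directed from $u$ to $v$), let $N(e)=N^+(v)\cap N^-(u)$ be the set of vertices $w$ such that $vw$ and $wu$ are arcs of $D$; $D[S]$ denotes the subdigraph induced by $S \subseteq V(D)$. Theorem. There is a function $\mathrm{dense}:\mathbb{N}\times\mathbb{N}\to\mathbb{N}$ such that for all $t,\alpha\in\mathbb{N}$ and every finite oriented graph $D$ with independence number $\alpha$, if $\vec\chi(D[N(e)])\le t$ for every arc $e\in A(D)$, then $\vec\chi(D)\le \mathrm{dense}(t,\alpha)$. -/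

import Mathlib

namespace Digraph

variable {V : Type*}

/-- `D` is an oriented graph: it has no directed 2-cycle (and, taking `u = v`, no loop). -/
def IsOriented (D : Digraph V) : Prop :=
  ∀ u v, D.Adj u v → ¬ D.Adj v u

/-- The subdigraph `D[S]` induced on a set `S` of vertices. -/
def induce (D : Digraph V) (S : Set V) : Digraph S where
  Adj u v := D.Adj u v

/-- The out-neighborhood `N⁺(v)`. -/
def outNbhd (D : Digraph V) (v : V) : Set V := {w | D.Adj v w}

/-- The in-neighborhood `N⁻(v)`. -/
def inNbhd (D : Digraph V) (v : V) : Set V := {w | D.Adj w v}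

/-- The neighborhood `N(uv) = N⁺(v) ∩ N⁻(u)` of an arc `uv`. -/
def arcNbhd (D : Digraph V) (u v : V) : Set V := D.outNbhd v ∩ D.inNbhd u

/-- No vertex can be reached from itself by a directed walk of positive length; equivalently,
there is no directed cycle. -/
def IsAcyclic (D : Digraph V) : Prop := ∀ v, ¬ Relation.TransGen D.Adj v v

/-- The vertex set can be covered by `k` colour classes, each inducing an acyclic subdigraph. -/
def DiColorable (D : Digraph V) (k : ℕ) : Prop :=
  ∃ c : V → Fin k, ∀ i, (D.induce {v | c v = i}).IsAcyclic

/-- The dichromatic number: the least `k` such that `D` is `k`-dicolorable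
(`⊤` if there is none, which does not happen for finite loopless digraphs). -/
noncomputable def dichromaticNumber (D : Digraph V) : ℕ∞ :=
  ⨅ k : {k : ℕ // D.DiColorable k}, ((k : ℕ) : ℕ∞)

/-- A set of vertices that contains no arc. -/
def IsIndep (D : Digraph V) (S : Set V) : Prop := ∀ u ∈ S, ∀ v ∈ S, ¬ D.Adj u v

/-- The independence number: the maximum size of an independent set (for finite `V`). -/
noncomputable def indepNumber (D : Digraph V) : ℕ :=
  sSup {n : ℕ | ∃ S : Finset V, D.IsIndep (S : Set V) ∧ S.card = n}

end Digraph

open Relation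

universe u

/-! Induct on `α`. The vertices not adjacent to a given `v`, other than `v`, span a digraph of
smaller independence number, so all non-neighborhoods have bounded dichromatic number. Strong
components may be colored separately; in one of them fix `v` and split the rest into in-neighbors,
out-neighbors and non-neighbors of `v`.

Two facts handle the in-neighbors (the out-neighbors follow by reversing arcs). By
`colorableOn_outNbrs_inter_inNbrs`, each `u` in N⁻(v) has few-colorable out-neighborhood inside
N⁻(v): a shortest path from `v` to `u` catches each such vertex in the neighborhood of a path arc or
among the non-neighbors of a path vertex, at a place fixed by its distance from `v`. By
`colorableOn_of_outNbrs`, such local bounds give a global one. The reason is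
`exists_small_not_colorable`: either few vertices dominate, or there is a bounded set that needs
many colors, and this set must itself dominate. -/

/-- The restriction of `r` to `S` has no directed cycle. -/
def AcyclicOn {V : Type u} (r : V → V → Prop) (S : Set V) : Prop :=
  ∀ v, ¬ TransGen (fun x y => x ∈ S ∧ y ∈ S ∧ r x y) v v

/-- `S` can be covered by `k` classes on each of which `r` is acyclic. -/
def ColorableOn {V : Type u} (r : V → V → Prop) (S : Set V) (k : ℕ) : Prop :=
  ∃ c : V → ℕ, (∀ v ∈ S, c v < k) ∧ ∀ i, AcyclicOn r {v | v ∈ S ∧ c v = i}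

/-- The vertices that are not adjacent to `v` in either direction, including `v`. -/
def nonNbrs {V : Type u} (r : V → V → Prop) (v : V) : Set V := {w | ¬ r v w ∧ ¬ r w v}

/-- The neighborhood of the arc `uv`, empty if `uv` is not an arc. -/
def arcNbrs {V : Type u} (r : V → V → Prop) (u v : V) : Set V := {w | r u v ∧ r v w ∧ r w u}

/-- Every independent set has at most `α` elements. -/
def IndepBound {V : Type u} (r : V → V → Prop) (α : ℕ) : Prop :=
  ∀ F : Finset V, (∀ u ∈ F, ∀ v ∈ F, ¬ r u v) → F.card ≤ α

/-- Some subset of `U` with at most `n` elements out-dominates `U`. -/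
def DominatedBy {V : Type u} (r : V → V → Prop) (U : Set V) (n : ℕ) : Prop :=
  ∃ B : Finset V, ↑B ⊆ U ∧ B.card ≤ n ∧ ∀ x ∈ U, x ∈ B ∨ ∃ b ∈ B, r b x

/-! ### Calculus of acyclic colorings -/

section Coloring

variable {V : Type u} {r : V → V → Prop} {S T : Set V} {k l : ℕ}

theorem AcyclicOn.mono (h : AcyclicOn r T) (hST : S ⊆ T) : AcyclicOn r S := fun v hv =>
  h v (TransGen.mono (fun _ _ ⟨hx, hy, hr⟩ => ⟨hST hx, hST hy, hr⟩) _ _ hv)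

theorem AcyclicOn.flip (h : AcyclicOn r S) : AcyclicOn (flip r) S := fun v hv =>
  h v (TransGen.mono (fun _ _ ⟨hx, hy, hr⟩ => ⟨hy, hx, hr⟩) _ _ (transGen_swap.2 hv))

theorem ColorableOn.mono (h : ColorableOn r T k) (hST : S ⊆ T) (hkl : k ≤ l) :
    ColorableOn r S l := by
  obtain ⟨c, hc, hac⟩ := h
  exact ⟨c, fun v hv => (hc v (hST hv)).trans_le hkl,
    fun i => (hac i).mono fun v hv => ⟨hST hv.1, hv.2⟩⟩

theorem ColorableOn.flip (h : ColorableOn r S k) : ColorableOn (flip r) S k := by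
  obtain ⟨c, hc, hac⟩ := h
  exact ⟨c, hc, fun i => (hac i).flip⟩

theorem colorableOn_empty : ColorableOn r ∅ k :=
  ⟨fun _ => 0, fun _ h => h.elim, fun i v hv => by
    obtain ⟨_, h, _⟩ := TransGen.head'_iff.1 hv
    exact h.1.1⟩

theorem ColorableOn.union (hS : ColorableOn r S k) (hT : ColorableOn r T l) :
    ColorableOn r (S ∪ T) (k + l) := by
  classical
  obtain ⟨c, hc, hac⟩ := hS
  obtain ⟨d, hd, had⟩ := hT
  refine ⟨fun v => if v ∈ S then c v else k + d v, fun v hv => ?_, fun i => ?_⟩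
  · by_cases h : v ∈ S
    · simpa [h] using (hc v h).trans_le (Nat.le_add_right _ _)
    · simpa [h] using hd v (hv.resolve_left h)
  · by_cases hi : i < k
    · refine (hac i).mono fun v hv => ?_
      obtain ⟨hv, hvi⟩ := hv
      by_cases h : v ∈ S
      · simp only [h, if_true] at hvi
        exact ⟨h, hvi⟩
      · simp only [h, if_false] at hvi
        omega
    · refine (had (i - k)).mono fun v hv => ?_
      obtain ⟨hv, hvi⟩ := hv
      by_cases h : v ∈ S
      · simp only [h, if_true] at hvi
        have := hc v h
        omega
      · simp only [h, if_false] at hvi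
        exact ⟨hv.resolve_left h, by omega⟩

theorem ColorableOn.biUnion {ι : Type*} (F : Finset ι) (f : ι → Set V)
    (h : ∀ i ∈ F, ColorableOn r (f i) k) : ColorableOn r (⋃ i ∈ F, f i) (F.card * k) := by
  classical
  induction F using Finset.induction_on with
  | empty => simpa using colorableOn_empty
  | insert a F ha ih =>
    rw [Finset.set_biUnion_insert, Finset.card_insert_of_notMem ha, Nat.succ_mul, add_comm]
    exact (h a (by simp)).union (ih fun i hi => h i (by simp [hi]))

/-- A cycle stays within one fiber of a map that is monotone along the arcs. -/
theorem transGen_fiber {β : Type*} [PartialOrder β] {q : V → V → Prop} {g : V → β}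
    (hg : ∀ x y, q x y → g x ≤ g y) {v : V} (hv : TransGen q v v) :
    TransGen (fun x y => g x = g v ∧ g y = g v ∧ q x y) v v := by
  have mono : ∀ {x y}, ReflTransGen q x y → g x ≤ g y := fun h => by
    induction h with
    | refl => exact le_rfl
    | tail _ h ih => exact ih.trans (hg _ _ h)
  suffices H : ∀ w, TransGen q v w → ReflTransGen q w v →
      TransGen (fun x y => g x = g v ∧ g y = g v ∧ q x y) v w from H v hv .refl
  intro w hw
  induction hw with
  | single h =>
    intro h'
    exact .single ⟨rfl, le_antisymm (mono h') (hg _ _ h), h⟩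
  | tail h₁ h ih =>
    intro h'
    have h₂ := mono (ReflTransGen.head h h')
    exact .tail (ih (.head h h')) ⟨le_antisymm h₂ (mono h₁.to_reflTransGen),
      le_antisymm (mono h') ((mono h₁.to_reflTransGen).trans (hg _ _ h)), h⟩

/-- A directed cycle cannot leave a fiber of `g`, so all fibers can share one palette. -/
theorem ColorableOn.of_fibers {β : Type*} [PartialOrder β] (g : V → β)
    (hg : ∀ x ∈ S, ∀ y ∈ S, r x y → g x ≤ g y)
    (h : ∀ b, ColorableOn r {x | x ∈ S ∧ g x = b} k) : ColorableOn r S k := by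
  choose c hc hac using h
  refine ⟨fun v => c (g v) v, fun v hv => hc _ v ⟨hv, rfl⟩, fun i v hv => hac (g v) i v ?_⟩
  refine TransGen.mono ?_ _ _
    (transGen_fiber (g := g) (fun x y h => hg x h.1.1 y h.2.1.1 h.2.2) hv)
  rintro x y ⟨hx, hy, ⟨hxS, hxi⟩, ⟨hyS, hyi⟩, hxy⟩
  exact ⟨⟨⟨hxS, hx⟩, hx ▸ hxi⟩, ⟨⟨hyS, hy⟩, hy ▸ hyi⟩, hxy⟩

/-- Within one parity class of `f` a drop of at most one is no drop at all, so `f` is monotone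
there; two palettes serve any number of layers. -/
theorem ColorableOn.of_layers (f : V → ℕ) (hf : ∀ x ∈ S, ∀ y ∈ S, r x y → f x ≤ f y + 1)
    (h : ∀ n, ColorableOn r {x | x ∈ S ∧ f x = n} k) : ColorableOn r S (2 * k) := by
  have key : ∀ e, ColorableOn r {x | x ∈ S ∧ f x % 2 = e} k := fun e => by
    refine .of_fibers f ?_ fun n => (h n).mono (fun x hx => ⟨hx.1.1, hx.2⟩) le_rfl
    rintro x ⟨hx, hx'⟩ y ⟨hy, hy'⟩ hxy
    have := hf x hx y hy hxy
    omega
  refine ((key 0).union (key 1)).mono (fun x hx => ?_) (by omega)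
  rcases Nat.mod_two_eq_zero_or_one (f x) with h | h
  · exact .inl ⟨hx, h⟩
  · exact .inr ⟨hx, h⟩

theorem ColorableOn.preimage {W : Type*} (f : W → V) (h : ColorableOn r S k) :
    ColorableOn (fun x y => r (f x) (f y)) (f ⁻¹' S) k := by
  obtain ⟨c, hc, hac⟩ := h
  refine ⟨fun w => c (f w), fun w hw => hc _ hw, fun i w hw => hac i (f w) ?_⟩
  exact TransGen.lift f (fun _ _ h => h) _ _ hw

theorem ColorableOn.of_subtype
    (h : ColorableOn (fun x y : S => r x y) Set.univ k) : ColorableOn r S k := by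
  classical
  obtain ⟨c, hc, hac⟩ := h
  refine ⟨fun v => if hv : v ∈ S then c ⟨v, hv⟩ else 0, fun v hv => by simp [hv, hc], ?_⟩
  intro i v hv
  have key : ∀ w, TransGen (fun x y =>
      x ∈ {v | v ∈ S ∧ (if hv : v ∈ S then c ⟨v, hv⟩ else 0) = i} ∧
      y ∈ {v | v ∈ S ∧ (if hv : v ∈ S then c ⟨v, hv⟩ else 0) = i} ∧ r x y) v w →
      ∃ (hv : v ∈ S) (hw : w ∈ S), TransGen (fun x y : S => x ∈ {v | v ∈ Set.univ ∧ c v = i} ∧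
        y ∈ {v | v ∈ Set.univ ∧ c v = i} ∧ r x y) ⟨v, hv⟩ ⟨w, hw⟩ := by
    intro w hw
    induction hw with
    | single h =>
      obtain ⟨⟨h₁, h₁'⟩, ⟨h₂, h₂'⟩, h⟩ := h
      simp only [h₁, h₂, dif_pos] at h₁' h₂'
      exact ⟨h₁, h₂, .single ⟨⟨trivial, h₁'⟩, ⟨trivial, h₂'⟩, h⟩⟩
    | tail _ h ih =>
      obtain ⟨⟨h₁, h₁'⟩, ⟨h₂, h₂'⟩, h⟩ := h
      simp only [h₁, h₂, dif_pos] at h₁' h₂'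
      obtain ⟨hv, _, ih⟩ := ih
      exact ⟨hv, h₂, ih.tail ⟨⟨trivial, h₁'⟩, ⟨trivial, h₂'⟩, h⟩⟩
  obtain ⟨_, _, h⟩ := key v hv
  exact hac i _ h

/-- If only `k` of the `k + 1` colors occur, then `k` colors suffice. -/
theorem ColorableOn.of_missing {c : V → ℕ} {i : ℕ} (hi : i < k + 1)
    (hc : ∀ v ∈ S, c v < k + 1) (hac : ∀ j, AcyclicOn r {v | v ∈ S ∧ c v = j})
    (hmiss : ∀ v ∈ S, c v ≠ i) : ColorableOn r S k := by
  refine ⟨fun v => if c v = k then i else c v, fun v hv => ?_, fun j => ?_⟩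
  · have := hc v hv
    have := hmiss v hv
    dsimp only
    split_ifs <;> omega
  · by_cases hj : j = i
    · refine (hac k).mono fun v hv => ⟨hv.1, ?_⟩
      have := hmiss v hv.1
      have := hv.2
      dsimp only at this
      split_ifs at this <;> omega
    · refine (hac j).mono fun v hv => ⟨hv.1, ?_⟩
      have := hv.2
      dsimp only at this
      split_ifs at this <;> omega

end Coloring

/-! ### Kernels and dominating sets -/

section Domination

variable {V : Type u} {r : V → V → Prop} {S T : Set V} {α k l : ℕ}

/-- An acyclic finite set contains an independent dominating set. -/
theorem AcyclicOn.exists_kernel (C : Finset V) (hC : AcyclicOn r C) :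
    ∃ Q ⊆ C, (∀ u ∈ Q, ∀ v ∈ Q, ¬ r u v) ∧ ∀ x ∈ C, x ∈ Q ∨ ∃ q ∈ Q, r q x := by
  classical
  induction C using Finset.strongInduction with
  | H C ih =>
  rcases C.eq_empty_or_nonempty with rfl | hne
  · exact ⟨∅, by simp⟩
  -- Take a source `c`, delete its out-neighbors and recurse on what remains.
  obtain ⟨c, hcC, hc⟩ : ∃ c ∈ C, ∀ x ∈ C, ¬ r x c := by
    let q : C → C → Prop := TransGen fun x y => r x y
    have : IsTrans C q := ⟨fun _ _ _ => TransGen.trans⟩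
    have : Std.Irrefl q := ⟨fun x hx => hC x
      (TransGen.lift Subtype.val (fun a b h => ⟨a.2, b.2, h⟩) _ _ hx)⟩
    have : Nonempty C := hne.to_subtype
    obtain ⟨c, -, hc⟩ := (Finite.wellFounded_of_trans_of_irrefl q).has_min Set.univ
      Set.univ_nonempty
    exact ⟨c, c.2, fun x hx h => hc ⟨x, hx⟩ trivial (.single h)⟩
  let C' := (C.erase c).filter fun x => ¬ r c x
  have hC'C : C' ⊆ C := (Finset.filter_subset _ _).trans (Finset.erase_subset _ _)
  obtain ⟨Q, hQ, hind, hdom⟩ := ih C' (Finset.ssubset_iff_subset_ne.2 ⟨hC'C, fun h => by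
    have : c ∈ C' := h ▸ hcC
    simp [C'] at this⟩) (hC.mono (by exact_mod_cast hC'C))
  refine ⟨insert c Q, ?_, ?_, fun x hx => ?_⟩
  · exact Finset.insert_subset hcC (hQ.trans hC'C)
  · intro u hu v hv huv
    rcases Finset.mem_insert.1 hv with hvc | hv
    · refine hc u ?_ (hvc ▸ huv)
      rcases Finset.mem_insert.1 hu with hu | hu
      exacts [hu ▸ hcC, hC'C (hQ hu)]
    · rcases Finset.mem_insert.1 hu with huc | hu
      · exact (Finset.mem_filter.1 (hQ hv)).2 (huc ▸ huv)
      · exact hind u hu v hv huv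
  · by_cases hxc : x = c
    · simp [hxc]
    by_cases hr : r c x
    · exact .inr ⟨c, by simp, hr⟩
    rcases hdom x (by simp [C', hxc, hr, hx]) with h | ⟨q, hq, h⟩
    · exact .inl (by simp [h])
    · exact .inr ⟨q, by simp [hq], h⟩

theorem DominatedBy.mono (h : DominatedBy r S k) (hkl : k ≤ l) : DominatedBy r S l := by
  obtain ⟨B, hB, hk, hd⟩ := h
  exact ⟨B, hB, hk.trans hkl, hd⟩

theorem DominatedBy.union (hS : DominatedBy r S k) (hT : DominatedBy r T l) :
    DominatedBy r (S ∪ T) (k + l) := by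
  classical
  obtain ⟨B, hB, hk, hd⟩ := hS
  obtain ⟨B', hB', hk', hd'⟩ := hT
  refine ⟨B ∪ B', ?_, (Finset.card_union_le _ _).trans (add_le_add hk hk'), ?_⟩
  · rw [Finset.coe_union]
    exact Set.union_subset_union hB hB'
  · rintro x (hx | hx)
    · rcases hd x hx with h | ⟨b, hb, h⟩
      · exact .inl (by simp [h])
      · exact .inr ⟨b, by simp [hb], h⟩
    · rcases hd' x hx with h | ⟨b, hb, h⟩
      · exact .inl (by simp [h])
      · exact .inr ⟨b, by simp [hb], h⟩

theorem DominatedBy.biUnion {ι : Type*} (F : Finset ι) (f : ι → Set V)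
    (h : ∀ i ∈ F, DominatedBy r (f i) k) : DominatedBy r (⋃ i ∈ F, f i) (F.card * k) := by
  classical
  induction F using Finset.induction_on with
  | empty => exact ⟨∅, by simp⟩
  | insert a F ha ih =>
    rw [Finset.set_biUnion_insert, Finset.card_insert_of_notMem ha, Nat.succ_mul, add_comm]
    exact (h a (by simp)).union (ih fun i hi => h i (by simp [hi]))

theorem AcyclicOn.dominatedBy [Finite V] (hα : IndepBound r α) (hS : AcyclicOn r S) :
    DominatedBy r S α := by
  classical
  obtain ⟨C, rfl⟩ := S.toFinite.exists_finset_coe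
  obtain ⟨Q, hQ, hind, hdom⟩ := AcyclicOn.exists_kernel C hS
  exact ⟨Q, by exact_mod_cast hQ, hα Q hind, by exact_mod_cast hdom⟩

theorem ColorableOn.dominatedBy [Finite V] (hα : IndepBound r α) (hS : ColorableOn r S k) :
    DominatedBy r S (k * α) := by
  obtain ⟨c, hc, hac⟩ := hS
  have h := DominatedBy.biUnion (Finset.range k) (fun i => {v | v ∈ S ∧ c v = i})
    fun i _ => (hac i).dominatedBy hα
  rw [Finset.card_range] at h
  convert h using 1
  ext v
  simp only [Set.mem_iUnion, Finset.mem_range, Set.mem_ofPred_eq, exists_prop]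
  exact ⟨fun hv => ⟨c v, hc v hv, hv, rfl⟩, fun ⟨_, _, hv, _⟩ => hv⟩

end Domination

/-! ### From domination to coloring -/

/-- A set of large domination number contains a bounded-size set that is not `k`-colorable. -/
theorem exists_small_not_colorable (α s k : ℕ) : ∃ K l : ℕ, ∀ (V : Type u) [Finite V]
    (r : V → V → Prop), IndepBound r α → (∀ v, ColorableOn r (nonNbrs r v) s) →
    ∀ U : Set V, ¬ DominatedBy r U K →
      ∃ A : Finset V, ↑A ⊆ U ∧ A.card ≤ l ∧ ¬ ColorableOn r A k := by
  classical
  induction k with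
  | zero =>
    refine ⟨0, 1, fun V _ r _ _ U hU => ?_⟩
    obtain ⟨x, hx⟩ : U.Nonempty := by
      by_contra h
      rw [Set.not_nonempty_iff_eq_empty] at h
      exact hU ⟨∅, by simp [h]⟩
    refine ⟨{x}, by simpa using hx, by simp, fun ⟨c, hc, _⟩ => ?_⟩
    exact absurd (hc x (by simp)) (Nat.not_lt_zero _)
  | succ k ih =>
  obtain ⟨K, l, hKl⟩ := ih
  -- `K₀` exceeds the cost of dominating a gadget region together with the non-neighbors of a
  -- kernel. Size `w` forces a color class in `W` with room for `K₀` vertices outside its kernel.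
  let K₀ := K + α * (s * α) + 1
  let w := (k + 1) * (K₀ + α)
  refine ⟨w, w + 2 ^ w * 2 ^ w * l, fun V _ r hα hN U hU => ?_⟩
  obtain ⟨B, hBU, hBdom, hBmin⟩ : ∃ B : Finset V, ↑B ⊆ U ∧ (∀ x ∈ U, x ∈ B ∨ ∃ b ∈ B, r b x) ∧
      ∀ n, DominatedBy r U n → B.card ≤ n := by
    have hex : ∃ n, DominatedBy r U n := by
      obtain ⟨C, rfl⟩ := U.toFinite.exists_finset_coe
      exact ⟨C.card, C, subset_rfl, le_rfl, fun x hx => .inl (by exact_mod_cast hx)⟩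
    obtain ⟨B, hBU, hB, hd⟩ := Nat.find_spec hex
    exact ⟨B, hBU, hd, fun n hn => hB.trans (Nat.find_min' hex hn)⟩
  have hwB : w ≤ B.card := by
    by_contra h
    exact hU ⟨B, hBU, by omega, hBdom⟩
  obtain ⟨W, hWB, hW⟩ := Finset.exists_subset_card_eq hwB
  have hgadget : ∀ S Q : Finset V, ∃ A : Finset V, ↑A ⊆ U ∧ A.card ≤ l ∧
      (S ⊆ W → S.card = K₀ → Q.card ≤ α → ¬ ColorableOn r A k ∧
        ∀ x ∈ A, (∀ b ∈ B, b ∉ S → x ≠ b ∧ ¬ r b x) ∧ ∀ q ∈ Q, x ∉ nonNbrs r q) := by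
    intro S Q
    by_cases h : S ⊆ W ∧ S.card = K₀ ∧ Q.card ≤ α
    swap
    -- Inadmissible pairs get an empty gadget.
    · exact ⟨∅, by simp, by simp, fun h₁ h₂ h₃ => absurd ⟨h₁, h₂, h₃⟩ h⟩
    obtain ⟨hSW, hS, hQ⟩ := h
    let X : Set V := {x | x ∈ U ∧ ∀ b ∈ B, b ∉ S → x ≠ b ∧ ¬ r b x}
    let N : Set V := ⋃ q ∈ Q, nonNbrs r q
    -- `X` is what only `S` dominates; a cheap dominating set for `X` could replace `S` in `B`,
    -- against minimality.
    have hX : ¬ DominatedBy r (X \ N) K := by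
      intro hd
      have hN' : DominatedBy r (N ∩ X) (Q.card * (s * α)) := by
        have h := DominatedBy.biUnion (r := r) (k := s * α) Q (fun q => nonNbrs r q ∩ X) fun q _ =>
          ((hN q).mono Set.inter_subset_left le_rfl).dominatedBy hα
        rwa [← Set.iUnion₂_inter] at h
      have hX : DominatedBy r X (K + α * (s * α)) := by
        have := (hd.union hN').mono (Nat.add_le_add_left (Nat.mul_le_mul_right _ hQ) K)
        rwa [Set.inter_comm, Set.sdiff_union_inter] at this
      obtain ⟨B', hB'X, hB', hB'd⟩ := hX
      have := hBmin ((B \ S ∪ B').card) ⟨B \ S ∪ B', ?_, le_rfl, ?_⟩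
      · have h₁ := Finset.card_union_le (B \ S) B'
        have h₂ := Finset.card_sdiff_add_card_eq_card (hSW.trans hWB)
        omega
      · intro x hx
        rcases Finset.mem_union.1 (Finset.mem_coe.1 hx) with hx | hx
        · exact hBU (Finset.mem_sdiff.1 hx).1
        · exact (hB'X hx).1
      · intro x hx
        by_cases hxX : x ∈ X
        · rcases hB'd x hxX with h | ⟨b, hb, h⟩
          · exact .inl (Finset.mem_union_right _ h)
          · exact .inr ⟨b, Finset.mem_union_right _ hb, h⟩
        · have : ∃ b ∈ B, b ∉ S ∧ (x ≠ b → r b x) := by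
            by_contra hcon
            push Not at hcon
            exact hxX ⟨hx, hcon⟩
          obtain ⟨b, hb, hbS, h⟩ := this
          have hb' : b ∈ B \ S ∪ B' := by simp [hb, hbS]
          by_cases hxb : x = b
          · exact .inl (hxb ▸ hb')
          · exact .inr ⟨b, hb', h hxb⟩
    obtain ⟨A, hA, hAl, hAk⟩ := hKl V r hα hN _ hX
    refine ⟨A, fun x hx => (hA hx).1.1, hAl, fun _ _ _ => ⟨hAk, fun x hx => ⟨(hA hx).1.2, ?_⟩⟩⟩
    intro q hq hxq
    exact (hA hx).2 (Set.mem_biUnion hq hxq)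
  choose f hfU hfl hf using hgadget
  let G := (W.powerset ×ˢ W.powerset).biUnion fun p => f p.1 p.2
  refine ⟨W ∪ G, ?_, ?_, ?_⟩
  · intro x hx
    rcases Finset.mem_union.1 (Finset.mem_coe.1 hx) with hx | hx
    · exact hBU (hWB hx)
    · obtain ⟨p, -, hx⟩ := Finset.mem_biUnion.1 hx
      exact hfU _ _ hx
  · refine (Finset.card_union_le _ _).trans (add_le_add hW.le ?_)
    refine (Finset.card_biUnion_le_card_mul _ _ l fun p _ => hfl _ _).trans_eq ?_
    rw [Finset.card_product, Finset.card_powerset, hW]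
  · rintro ⟨c, hc, hac⟩
    obtain ⟨i, hi, hCi⟩ := Finset.exists_le_card_fiber_of_mul_le_card_of_maps_to
      (s := W) (t := Finset.range (k + 1)) (f := c) (n := K₀ + α)
      (fun x hx => Finset.mem_range.2 (hc x (by simp [hx]))) ⟨0, by simp⟩
      (by rw [Finset.card_range, hW])
    set C := W.filter fun x => c x = i with hC
    have hCc : ∀ x ∈ C, x ∈ W ∧ c x = i := fun x hx => Finset.mem_filter.1 hx
    obtain ⟨Q, hQC, hQind, hQdom⟩ := AcyclicOn.exists_kernel (r := r) C
      ((hac i).mono fun x hx => ⟨by simp [(hCc x hx).1], (hCc x hx).2⟩)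
    have hQα := hα Q hQind
    obtain ⟨S, hSC, hS⟩ : ∃ S ⊆ C \ Q, S.card = K₀ := by
      refine Finset.exists_subset_card_eq ?_
      have := Finset.card_sdiff_add_card_eq_card hQC
      omega
    have hSC' : ∀ x ∈ S, x ∈ C ∧ x ∉ Q := fun x hx => Finset.mem_sdiff.1 (hSC hx)
    have hSW : S ⊆ W := fun x hx => (hCc x (hSC' x hx).1).1
    have hQW : Q ⊆ W := fun x hx => (hCc x (hQC hx)).1
    obtain ⟨hncol, hA⟩ := hf S Q hSW hS hQα
    have hAG : f S Q ⊆ W ∪ G := fun x hx => Finset.mem_union_right _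
      (Finset.mem_biUnion.2 ⟨(S, Q), by simp [hSW, hQW], hx⟩)
    -- The gadget is not `k`-colorable, so it uses color `i` too. This yields a monochromatic
    -- triangle `b → x → q → b` with `b ∈ S`, `q ∈ Q`.
    obtain ⟨x, hxA, hxi⟩ : ∃ x ∈ f S Q, c x = i := by
      by_contra hcon
      push Not at hcon
      exact hncol (.of_missing (Finset.mem_range.1 hi) (fun v hv => hc v (hAG hv))
        (fun j => (hac j).mono fun v hv => ⟨hAG hv.1, hv.2⟩) hcon)
    obtain ⟨hxB, hxQ⟩ := hA x hxA
    have hQB : ∀ q ∈ Q, x ≠ q ∧ ¬ r q x := fun q hq =>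
      hxB q (hWB (hQW hq)) fun hqS => (hSC' q hqS).2 hq
    obtain ⟨b, hbS, hbx⟩ : ∃ b ∈ S, r b x := by
      rcases hBdom x (hfU _ _ hxA) with h | ⟨b, hb, h⟩
      · by_cases hxS : x ∈ S
        · rcases hQdom x (hSC' x hxS).1 with hq | ⟨q, hq, hqx⟩
          · exact absurd hq (hSC' x hxS).2
          · exact absurd hqx (hQB q hq).2
        · exact absurd rfl (hxB x h hxS).1
      · by_cases hbS : b ∈ S
        · exact ⟨b, hbS, h⟩
        · exact absurd h (hxB b hb hbS).2
    obtain ⟨q, hq, hqb⟩ : ∃ q ∈ Q, r q b :=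
      (hQdom b (hSC' b hbS).1).resolve_left (hSC' b hbS).2
    have hxq : r x q := by
      by_contra h
      exact hxQ q hq ⟨(hQB q hq).2, h⟩
    have hb := hCc b (hSC' b hbS).1
    have hq' := hCc q (hQC hq)
    have memb : b ∈ {v | v ∈ (↑(W ∪ G) : Set V) ∧ c v = i} := ⟨by simp [hb.1], hb.2⟩
    have memq : q ∈ {v | v ∈ (↑(W ∪ G) : Set V) ∧ c v = i} := ⟨by simp [hq'.1], hq'.2⟩
    have memx : x ∈ {v | v ∈ (↑(W ∪ G) : Set V) ∧ c v = i} := ⟨hAG hxA, hxi⟩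
    exact hac i b (((TransGen.single ⟨memb, memx, hbx⟩).tail ⟨memx, memq, hxq⟩).tail
      ⟨memq, memb, hqb⟩)

/-- If out-neighborhoods and non-neighborhoods have bounded dichromatic number, then so has the
whole set. -/
theorem colorableOn_of_outNbrs (α s : ℕ) : ∃ N : ℕ, ∀ (V : Type u) [Finite V]
    (r : V → V → Prop), IndepBound r α → (∀ v, ColorableOn r (nonNbrs r v) s) →
    ∀ P : Set V, (∀ v ∈ P, ColorableOn r {w | w ∈ P ∧ r v w} s) → (∀ v, ¬ r v v) →
      ColorableOn r P N := by
  obtain ⟨K, l, h⟩ := exists_small_not_colorable.{u} α s (s + s)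
  refine ⟨max K l * (s + s), fun V _ r hα hN P hP hirr => ?_⟩
  obtain ⟨B, hBP, hB, hBd⟩ : DominatedBy r P (max K l) := by
    by_cases hK : DominatedBy r P K
    · exact hK.mono (le_max_left _ _)
    obtain ⟨A, hAP, hAl, hA⟩ := h V r hα hN P hK
    refine ⟨A, hAP, hAl.trans (le_max_right _ _), fun x hx => ?_⟩
    by_contra hcon
    push Not at hcon
    -- A vertex `x` undominated by `A` would have all of `A` among its out-neighbors and
    -- non-neighbors, making `A` colorable.
    refine hA (((hP x hx).union (hN x)).mono (fun a ha => ?_) le_rfl)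
    by_cases hxa : r x a
    · exact .inl ⟨hAP ha, hxa⟩
    · exact .inr ⟨hxa, hcon.2 a ha⟩
  refine (ColorableOn.biUnion B (fun b => {w | w ∈ P ∧ r b w} ∪ nonNbrs r b)
    fun b hb => (hP b (hBP hb)).union (hN b)).mono (fun x hx => ?_) (Nat.mul_le_mul_right _ hB)
  rcases hBd x hx with hxB | ⟨b, hb, hbx⟩
  · exact Set.mem_biUnion hxB (.inr ⟨hirr x, hirr x⟩)
  · exact Set.mem_biUnion hb (.inl ⟨hx, hbx⟩)

/-! ### Shortest paths and distance layers -/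

section Distance

variable {V : Type u} {r : V → V → Prop}

/-- There is a directed walk of length `n` from `x` to `y`. -/
def WalkOfLength (r : V → V → Prop) : ℕ → V → V → Prop
  | 0, x, y => x = y
  | n + 1, x, y => ∃ z, r x z ∧ WalkOfLength r n z y

theorem WalkOfLength.trans {m n : ℕ} {x y z : V} (h : WalkOfLength r m x y)
    (h' : WalkOfLength r n y z) : WalkOfLength r (m + n) x z := by
  induction m generalizing x with
  | zero =>
    obtain rfl : x = y := h
    simpa using h'
  | succ m ih =>
    obtain ⟨w, hw, h⟩ := h
    rw [Nat.add_right_comm]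
    exact ⟨w, hw, ih h⟩

theorem WalkOfLength.single {x y : V} (h : r x y) : WalkOfLength r 1 x y := ⟨y, h, rfl⟩

theorem WalkOfLength.exists_path {n : ℕ} {x y : V} (h : WalkOfLength r n x y) :
    ∃ p : ℕ → V, p 0 = x ∧ p n = y ∧ (∀ i < n, r (p i) (p (i + 1))) ∧
      (∀ i ≤ n, WalkOfLength r i x (p i)) ∧ ∀ i ≤ n, WalkOfLength r (n - i) (p i) y := by
  induction n generalizing x with
  | zero => exact ⟨fun _ => x, rfl, h, by simp, by simp [WalkOfLength], by simpa using h⟩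
  | succ n ih =>
    obtain ⟨z, hz, h⟩ := h
    obtain ⟨p, hp0, hpn, h₀, h₁, h₂⟩ := ih h
    refine ⟨fun | 0 => x | i + 1 => p i, rfl, hpn, fun i hi => ?_, fun i hi => ?_, fun i hi => ?_⟩
    · cases i with
      | zero =>
        change r x (p 0)
        exact hp0.symm ▸ hz
      | succ i => exact h₀ i (by omega)
    · cases i with
      | zero => exact rfl
      | succ i => exact ⟨z, hz, h₁ i (by omega)⟩
    · cases i with
      | zero => exact ⟨z, hz, h⟩
      | succ i =>
        rw [Nat.add_sub_add_right]
        exact h₂ i (by omega)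

theorem Relation.ReflTransGen.exists_walk {x y : V} (h : ReflTransGen r x y) :
    ∃ n, WalkOfLength r n x y := by
  induction h using ReflTransGen.head_induction_on with
  | refl => exact ⟨0, rfl⟩
  | head h _ ih =>
    obtain ⟨n, hn⟩ := ih
    exact ⟨n + 1, _, h, hn⟩

/-- The length of a shortest directed walk from `x` to `y` (`0` if there is none). -/
noncomputable def walkDist (r : V → V → Prop) (x y : V) : ℕ := sInf {n | WalkOfLength r n x y}

theorem walkDist_le {n : ℕ} {x y : V} (h : WalkOfLength r n x y) : walkDist r x y ≤ n :=
  Nat.sInf_le h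

theorem Relation.ReflTransGen.walkOfLength_walkDist {x y : V} (h : ReflTransGen r x y) :
    WalkOfLength r (walkDist r x y) x y := Nat.sInf_mem h.exists_walk

/-- If `b` is reachable from `c`, then `N⁺(b) ∩ N⁻(c)` has bounded dichromatic number. -/
theorem colorableOn_outNbrs_inter_inNbrs {s : ℕ} (hasymm : ∀ u v, r u v → ¬ r v u)
    (hN : ∀ v, ColorableOn r (nonNbrs r v) s) (hE : ∀ u v, ColorableOn r (arcNbrs r u v) s)
    {b c : V} (hcb : ReflTransGen r c b) : ColorableOn r {x | r b x ∧ r x c} (36 * s) := by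
  have hxb : ∀ x, r x c → ReflTransGen r x b := fun x h => .head h hcb
  have hcx : ∀ x, r b x → ReflTransGen r c x := fun x h => .tail hcb h
  set m := walkDist r c b with hm
  obtain ⟨p, hp0, hpm, hp, hp₁, hp₂⟩ := hcb.walkOfLength_walkDist.exists_path
  rw [← hm] at hpm hp hp₁ hp₂
  have core : ∀ k l, ColorableOn r
      {x | (r b x ∧ r x c) ∧ walkDist r x b = k ∧ walkDist r c x = l} (9 * s) := by
    intro k l
    -- The last path vertex `p i` that `x` points to has `i ≤ l + 1`, as `p` is shortest. If `i < l
    -- - 2`, then `p (l - 2)` is a non-neighbor of `x`; otherwise `i` takes one of four values, and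
    -- `p (i + 1)` is a non-neighbor or closes a triangle.
    refine ((hN (p (l - 2))).union (ColorableOn.biUnion (Finset.range 4)
      (fun j => nonNbrs r (p (l + j - 2 + 1)) ∪ arcNbrs r (p (l + j - 2)) (p (l + j - 2 + 1)))
      fun j _ => (hN _).union (hE _ _))).mono ?_ (by rw [Finset.card_range]; omega)
    rintro x ⟨⟨hbx, hxc⟩, hk, hl⟩
    have hmkl : m ≤ k + l := by
      have := walkDist_le
        ((hcx x hbx).walkOfLength_walkDist.trans (hxb x hxc).walkOfLength_walkDist)
      omega
    have hout : ∀ i ≤ m, r x (p i) → k + i ≤ m + 1 := fun i hi h => by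
      have := walkDist_le ((WalkOfLength.single h).trans (hp₂ i hi))
      omega
    have hin : ∀ i ≤ m, r (p i) x → l ≤ i + 1 := fun i hi h => by
      have := walkDist_le ((hp₁ i hi).trans (WalkOfLength.single h))
      omega
    have hlm : l ≤ m + 1 := hin m le_rfl (hpm ▸ hbx)
    classical
    obtain ⟨i, him, hi, hmax⟩ : ∃ i ≤ m, r x (p i) ∧ ∀ j ≤ m, r x (p j) → j ≤ i :=
      ⟨Nat.findGreatest (fun i => r x (p i)) m, Nat.findGreatest_le m,
        Nat.findGreatest_spec (P := fun i => r x (p i)) (Nat.zero_le m) (hp0 ▸ hxc),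
        fun j hj h => Nat.le_findGreatest hj h⟩
    have him' : i < m := lt_of_le_of_ne him fun h => by
      rw [h, hpm] at hi
      exact hasymm _ _ hi hbx
    by_cases hli : i + 2 < l
    · refine .inl ⟨fun h => ?_, fun h => ?_⟩
      · have := hin _ (by omega) h
        omega
      · have := hmax _ (by omega) h
        omega
    · refine .inr (Set.mem_biUnion (x := i + 2 - l) ?_ ?_)
      · have := hout i him hi
        simp only [Finset.coe_range, Set.mem_Iio]
        omega
      · have hii : l + (i + 2 - l) - 2 = i := by omega
        simp only [hii]
        have hni : ¬ r x (p (i + 1)) := fun h => by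
          have := hmax _ (by omega) h
          omega
        by_cases h : r (p (i + 1)) x
        · exact .inr ⟨hp i him', h, hi⟩
        · exact .inl ⟨h, hni⟩
  have level : ∀ k, ColorableOn r {x | (r b x ∧ r x c) ∧ walkDist r x b = k} (18 * s) := by
    intro k
    -- Distance from `c` rises by at most one along an arc, hence the reversal.
    have h := ColorableOn.of_layers (r := flip r)
      (S := {x | (r b x ∧ r x c) ∧ walkDist r x b = k}) (walkDist r c) (k := 9 * s) ?_ ?_
    · exact h.flip.mono subset_rfl (by omega)
    · intro x _ y hy hxy
      exact walkDist_le ((hcx y hy.1.1).walkOfLength_walkDist.trans (WalkOfLength.single hxy))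
    · exact fun l => (core k l).flip.mono (fun x hx => ⟨hx.1.1, hx.1.2, hx.2⟩) le_rfl
  refine (ColorableOn.of_layers (fun x => walkDist r x b) (k := 18 * s) ?_ level).mono
    subset_rfl (by omega)
  intro x _ y hy hxy
  rw [add_comm]
  exact walkDist_le ((WalkOfLength.single hxy).trans (hxb y hy.2).walkOfLength_walkDist)

end Distance

/-! ### Strong components and induction on the independence number -/

theorem nonNbrs_flip {V : Type u} (r : V → V → Prop) (v : V) :
    nonNbrs (flip r) v = nonNbrs r v :=
  Set.ext fun _ => and_comm

theorem IndepBound.flip {V : Type u} {r : V → V → Prop} {α : ℕ} (h : IndepBound r α) :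
    IndepBound (flip r) α := fun F hF => h F fun u hu v hv => hF v hv u hu

/-- Bounded arc neighborhoods and bounded non-neighborhoods give a bounded dichromatic number. -/
theorem colorableOn_univ_of_arcNbrs (α s : ℕ) : ∃ N : ℕ, ∀ (V : Type u) [Finite V]
    (r : V → V → Prop), (∀ u v, r u v → ¬ r v u) → IndepBound r α →
    (∀ v, ColorableOn r (nonNbrs r v) s) → (∀ u v, ColorableOn r (arcNbrs r u v) s) →
      ColorableOn r Set.univ N := by
  obtain ⟨N, h⟩ := colorableOn_of_outNbrs.{u} α (36 * s)
  refine ⟨N + N + s, fun V _ r hasymm hα hN hE => ?_⟩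
  have hirr : ∀ v, ¬ r v v := fun v hv => hasymm v v hv hv
  have hN' : ∀ v, ColorableOn r (nonNbrs r v) (36 * s) := fun v =>
    (hN v).mono subset_rfl (by omega)
  -- Ancestor sets grow along arcs, and their fibers are the strong components.
  refine .of_fibers (fun x => {w | ReflTransGen r w x})
    (fun x _ y _ hxy w (hw : ReflTransGen r w x) => hw.tail hxy) fun Z => ?_
  by_cases hZ : ∃ v, {w | ReflTransGen r w v} = Z
  swap
  · exact colorableOn_empty.mono (fun x hx => (hZ ⟨x, hx.2⟩).elim) (Nat.zero_le _)
  obtain ⟨v, rfl⟩ := hZ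
  have hreach : ∀ x y, {w | ReflTransGen r w x} = {w | ReflTransGen r w v} →
      {w | ReflTransGen r w y} = {w | ReflTransGen r w v} → ReflTransGen r x y := by
    intro x y hx hy
    have : x ∈ {w | ReflTransGen r w y} := hy ▸ hx ▸ ReflTransGen.refl
    exact this
  have hin := h V r hα hN'
    {x | {w | ReflTransGen r w x} = {w | ReflTransGen r w v} ∧ r x v}
    (fun u hu => (colorableOn_outNbrs_inter_inNbrs hasymm hN hE (hreach v u rfl hu.1)).mono
      (fun x hx => ⟨hx.2, hx.1.2⟩) le_rfl) hirr
  have hout := h V (flip r) hα.flip (fun u => by rw [nonNbrs_flip]; exact (hN' u).flip)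
    {x | {w | ReflTransGen r w x} = {w | ReflTransGen r w v} ∧ r v x}
    (fun u hu => ((colorableOn_outNbrs_inter_inNbrs hasymm hN hE (hreach u v hu.1 rfl)).mono
      (fun x hx => ⟨hx.1.2, hx.2⟩) le_rfl).flip) hirr
  refine ((hin.union hout.flip).union (hN v)).mono (fun x hx => ?_) le_rfl
  by_cases h₁ : r x v
  · exact .inl (.inl ⟨hx.2, h₁⟩)
  by_cases h₂ : r v x
  · exact .inl (.inr ⟨hx.2, h₂⟩)
  · exact .inr ⟨h₂, h₁⟩

/-- Bounded arc neighborhoods and bounded independence number give a bounded dichromatic number. -/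
theorem colorableOn_univ_of_indepBound (t α : ℕ) : ∃ N : ℕ, ∀ (V : Type u) [Finite V]
    (r : V → V → Prop), (∀ u v, r u v → ¬ r v u) → IndepBound r α →
    (∀ u v, ColorableOn r (arcNbrs r u v) t) → ColorableOn r Set.univ N := by
  classical
  induction α with
  | zero =>
    refine ⟨0, fun V _ r hasymm hα _ => colorableOn_empty.mono (fun x _ => ?_) le_rfl⟩
    have := hα {x} (by simpa using fun h => hasymm x x h h)
    simp at this
  | succ α ih =>
    obtain ⟨n, hn⟩ := ih
    obtain ⟨N, hN⟩ := colorableOn_univ_of_arcNbrs.{u} (α + 1) (1 + n + t)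
    refine ⟨N, fun V _ r hasymm hα hE => hN V r hasymm hα (fun v => ?_)
      fun u v => (hE u v).mono subset_rfl (by omega)⟩
    have hirr : ∀ v, ¬ r v v := fun v hv => hasymm v v hv hv
    have h₁ : ColorableOn r {v} 1 := by
      refine ⟨fun _ => 0, fun _ _ => Nat.one_pos, fun i w hw => ?_⟩
      obtain ⟨x, ⟨⟨hw, _⟩, ⟨hx, _⟩, hwx⟩, _⟩ := TransGen.head'_iff.1 hw
      obtain rfl : w = v := hw
      obtain rfl : x = w := hx
      exact hirr _ hwx
    have h₂ : ColorableOn r (nonNbrs r v \ {v}) n := by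
      refine .of_subtype (hn _ _ (fun x y => hasymm x y) (fun F hF => ?_) fun x y => ?_)
      -- Adding `v` to an independent set of its non-neighbors keeps it independent.
      · have := hα (insert v (F.map (Function.Embedding.subtype _))) ?_
        · rw [Finset.card_insert_of_notMem, Finset.card_map] at this
          · omega
          · intro hv
            obtain ⟨x, -, hx⟩ := Finset.mem_map.1 hv
            exact x.2.2 hx
        · intro x hx y hy
          rcases Finset.mem_insert.1 hx with hx | hx <;> rcases Finset.mem_insert.1 hy with hy | hy
          · rw [hx, hy]
            exact hirr v
          · obtain ⟨y, -, rfl⟩ := Finset.mem_map.1 hy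
            exact hx ▸ y.2.1.1
          · obtain ⟨x, -, rfl⟩ := Finset.mem_map.1 hx
            exact hy ▸ x.2.1.2
          · obtain ⟨x, hxF, rfl⟩ := Finset.mem_map.1 hx
            obtain ⟨y, hyF, rfl⟩ := Finset.mem_map.1 hy
            exact hF x hxF y hyF
      · exact (hE x y).preimage Subtype.val
    refine (h₁.union h₂).mono (fun x hx => ?_) (by omega)
    by_cases hxv : x = v
    · exact .inl hxv
    · exact .inr ⟨hx, hxv⟩

/-! ### Transfer to `Digraph` -/

namespace Digraph

variable {V : Type u}

theorem isAcyclic_induce_iff (D : Digraph V) (S : Set V) :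
    (D.induce S).IsAcyclic ↔ AcyclicOn D.Adj S := by
  constructor
  · intro h v hv
    have key : ∀ w, TransGen (fun x y => x ∈ S ∧ y ∈ S ∧ D.Adj x y) v w →
        ∃ (hv : v ∈ S) (hw : w ∈ S), TransGen (D.induce S).Adj ⟨v, hv⟩ ⟨w, hw⟩ := by
      intro w hw
      induction hw with
      | single h => exact ⟨h.1, h.2.1, .single h.2.2⟩
      | tail _ h ih =>
        obtain ⟨hv, _, ih⟩ := ih
        exact ⟨hv, h.2.1, ih.tail h.2.2⟩
    obtain ⟨hv, _, hc⟩ := key v hv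
    exact h _ hc
  · intro h v hv
    exact h v (TransGen.lift Subtype.val (fun x y hxy => ⟨x.2, y.2, hxy⟩) _ _ hv)

theorem diColorable_iff (D : Digraph V) (k : ℕ) :
    D.DiColorable k ↔ ColorableOn D.Adj Set.univ k := by
  constructor
  · rintro ⟨c, hc⟩
    refine ⟨fun v => c v, fun v _ => (c v).2, fun i v hv => ?_⟩
    obtain ⟨_, ⟨⟨_, h⟩, _⟩, _⟩ := TransGen.head'_iff.1 hv
    exact ((D.isAcyclic_induce_iff _).1 (hc (c v))).mono
      (fun w hw => Fin.ext (hw.2.trans h.symm)) v hv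
  · rintro ⟨c, hc, hac⟩
    exact ⟨fun v => ⟨c v, hc v trivial⟩, fun i => (D.isAcyclic_induce_iff _).2
      ((hac i).mono fun v hv => ⟨trivial, congrArg Fin.val hv⟩)⟩

theorem dichromaticNumber_le_iff (D : Digraph V) (k : ℕ) :
    D.dichromaticNumber ≤ k ↔ ColorableOn D.Adj Set.univ k := by
  constructor
  · intro h
    obtain ⟨⟨l, hl⟩, hlk⟩ := iInf_lt_iff.1
      (h.trans_lt (Nat.cast_lt.2 (Nat.lt_succ_self k) : (k : ℕ∞) < (k + 1 : ℕ)))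
    exact ((D.diColorable_iff l).1 hl).mono subset_rfl
      (Nat.lt_succ_iff.1 (Nat.cast_lt.1 hlk))
  · intro h
    exact iInf_le (fun l : {l : ℕ // D.DiColorable l} => ((l : ℕ) : ℕ∞))
      ⟨k, (D.diColorable_iff k).2 h⟩

theorem indepBound_indepNumber [Finite V] (D : Digraph V) :
    IndepBound D.Adj D.indepNumber := by
  intro F hF
  refine le_csSup ⟨Nat.card V, ?_⟩ ⟨F, hF, rfl⟩
  rintro _ ⟨S, -, rfl⟩
  have := Fintype.ofFinite V
  exact S.card_le_univ.trans_eq Nat.card_eq_fintype_card.symm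

end Digraph

theorem mainTheorem2 :
    ∃ dense : ℕ → ℕ → ℕ,
      ∀ (t α : ℕ) (V : Type*) [Finite V] (D : Digraph V),
        D.IsOriented →
        D.indepNumber = α →
        (∀ u v : V, D.Adj u v →
          (D.induce (D.arcNbhd u v)).dichromaticNumber ≤ (t : ℕ∞)) →
        D.dichromaticNumber ≤ (dense t α : ℕ∞) := by
  choose dense h using colorableOn_univ_of_indepBound
  refine ⟨dense, fun t α V _ D hD hα hE => (D.dichromaticNumber_le_iff _).2 ?_⟩
  refine h t α V D.Adj hD (hα ▸ D.indepBound_indepNumber) fun u v => ?_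
  by_cases huv : D.Adj u v
  · exact (ColorableOn.of_subtype ((Digraph.dichromaticNumber_le_iff _ t).1 (hE u v huv))).mono
      (fun w hw => hw.2) le_rfl
  · exact colorableOn_empty.mono (fun w hw => huv hw.1) (Nat.zero_le _)
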